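/- Let $S$ be a finite nonempty set and let $b:2^S\to\mathbb{R}\cup\{+\infty\}$ be a set function with $b(\emptyset)=0$ that is submodular, i.e. $b(X)+b(Y)\ge b(X\cap Y)+b(X\cup Y)$ whenever $b(X),b(Y)<+\infty$. The base-polyhedron defined by $b$ is $$B=\Big\{x\in\mathbb{R}^S:\ \sum_{s\in S}x(s)=b(S),\ \sum_{s\in Z}x(s)\le b(Z)\ \text{ for all } Z\subset S\Big\}.$$ It may be unbounded. Suppose that $B$ is nonempty and integral, i.e. $B$ is the convex hull of its integral points. For $x\in\mathbb{R}^S$ let $x{\downarrow}$ denote the vector of components of $x$ arranged in decreasing order. An element $m$ of a set $Q\subseteq\mathbb{R}^S$ is decreasingly minimal (dec-min) in $Q$ if, for every $y\in Q$, either $m{\downarrow}=y{\downarrow}$ or $m{\downarrow}$ is smaller than $y{\downarrow}$ in the first component in which they differ. **Theorem (Proximity).** Let $m_{\mathbb{R}}$ be the minimum norm point of $B$, i.e. the point of $B$ minimizing $\sum_{s\in S}x(s)^2$. Then every dec-min element $m_{\mathbb{Z}}$ of the M-convex set $B\cap\mathbb{Z}^S$ satisfies $$\lfloor m_{\mathbb{R}}(s)\rfloor\le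 m_{\mathbb{Z}}(s)\le\lceil m_{\mathbb{R}}(s)\rceil\qquad\text{for all } s\in S .$$ -/

import Mathlib

namespace DecMin

section Dec

variable {S α : Type*} [Fintype S] [LinearOrder α]

/-- The components of `x` rearranged in decreasing order. -/
def sortDown (x : S → α) : List α :=
  (Finset.univ.val.map x).sort (· ≥ ·)

/-- `x` is decreasingly smaller than `y`: at the first position where the two decreasing
rearrangements (lists of equal length) differ, the one of `x` has the smaller entry. -/
def DecLT (x y : S → α) : Prop :=
  List.Lex (· < ·) (sortDown x) (sortDown y)

/-- `x` is decreasingly smaller than, or value-equivalent to, `y`. -/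
def DecLE (x y : S → α) : Prop :=
  DecLT x y ∨ sortDown x = sortDown y

/-- `m` is a decreasingly minimal element of `Q`. -/
def IsDecMin (Q : Set (S → α)) (m : S → α) : Prop :=
  m ∈ Q ∧ ∀ y ∈ Q, DecLE m y

end Dec

section Base

variable {S : Type*}

/-- Submodularity of a set function with values in `ℝ ∪ {+∞}`. -/
def IsSubmodular [DecidableEq S] (b : Finset S → WithTop ℝ) : Prop :=
  ∀ X Y : Finset S, b X ≠ ⊤ → b Y ≠ ⊤ → b (X ∩ Y) + b (X ∪ Y) ≤ b X + b Y

/-- The polyhedron `{x | x(V) = b(V) for the ground set V, x(Z) ≤ b(Z) for all Z}`. -/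
def basePolyhedron [Fintype S] (b : Finset S → WithTop ℝ) : Set (S → ℝ) :=
  {x | ((∑ v, x v : ℝ) : WithTop ℝ) = b Finset.univ ∧
    ∀ Z : Finset S, ((∑ v ∈ Z, x v : ℝ) : WithTop ℝ) ≤ b Z}

/-- `B` is a (possibly unbounded) base-polyhedron. -/
def IsBasePolyhedron [Fintype S] [DecidableEq S] (B : Set (S → ℝ)) : Prop :=
  ∃ b : Finset S → WithTop ℝ, b ∅ = 0 ∧ IsSubmodular b ∧ B = basePolyhedron b

/-- The set of integral members of `B`, as integer vectors. -/
def integralPoints (B : Set (S → ℝ)) : Set (S → ℤ) :=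
  {z | (fun s => (z s : ℝ)) ∈ B}

/-- `B` is the convex hull of its integral members. -/
def IsIntegralPolyhedron (B : Set (S → ℝ)) : Prop :=
  convexHull ℝ ((fun (z : S → ℤ) (s : S) => (z s : ℝ)) '' integralPoints B) = B

/-- An integral base-polyhedron: a base-polyhedron that is an integral polyhedron. -/
def IsIntegralBasePolyhedron [Fintype S] [DecidableEq S] (B : Set (S → ℝ)) : Prop :=
  IsBasePolyhedron B ∧ IsIntegralPolyhedron B

/-- `m` is a point of `B` of minimum Euclidean norm (minimum square-sum). -/
def IsMinNormPoint [Fintype S] (B : Set (S → ℝ)) (m : S → ℝ) : Prop :=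
  m ∈ B ∧ ∀ x ∈ B, ∑ s, m s ^ 2 ≤ ∑ s, x s ^ 2

end Base

end DecMin

/-!
Base-polyhedra have the simultaneous exchange property: if `y s < x s`, some `t` with `x t < y t`
admits a feasible transfer from `s` to `t` at `x` and from `t` to `s` at `y`. Such a `t` lies in the
smallest `y`-tight set containing `s` but outside the largest `x`-tight set avoiding `s`.

At the minimum norm point a feasible transfer from `s` to `t` forces `mR s ≤ mR t`; at a dec-min
integral point it can be taken of unit size, by integrality, and forces `mZ s ≤ mZ t + 1`. If
`mZ s + 1 ≤ mR s`, an exchange would give `mR s ≤ mR t < mZ t ≤ mZ s + 1`, and symmetrically if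
`mR s + 1 ≤ mZ s`. Hence `|mR s - mZ s| < 1`, which is the claim.
-/

namespace DecMin

section Lex

variable {α : Type*} [LinearOrder α]

theorem orderedInsert_lt_orderedInsert (r : α) {L M : List α} (h : L < M) :
    L.orderedInsert (· ≥ ·) r < M.orderedInsert (· ≥ ·) r := by
  induction h with
  | @nil b M =>
    simp only [List.orderedInsert_nil, List.orderedInsert_cons]
    split_ifs with hb
    · exact .cons .nil
    · exact .rel (not_le.1 hb)
  | @cons a L M _ ih =>
    simp only [List.orderedInsert_cons]
    split_ifs
    · exact .cons (.cons ‹_›)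
    · exact .cons ih
  | @rel a L b M hab =>
    simp only [List.orderedInsert_cons]
    split_ifs with ha hb hb
    · exact .cons (.rel hab)
    · exact .rel (not_le.1 hb)
    · exact absurd (hab.le.trans hb) ha
    · exact .rel hab

theorem sort_cons_eq_orderedInsert (r : α) (A : Multiset α) :
    (r ::ₘ A).sort (· ≥ ·) = (A.sort (· ≥ ·)).orderedInsert (· ≥ ·) r := by
  induction A using Quotient.inductionOn with
  | h L => simp [List.mergeSort_eq_insertionSort]

theorem sort_add_lt_sort_add (R : Multiset α) {A C : Multiset α}
    (h : A.sort (· ≥ ·) < C.sort (· ≥ ·)) :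
    (R + A).sort (· ≥ ·) < (R + C).sort (· ≥ ·) := by
  induction R using Multiset.induction_on with
  | empty => simpa only [zero_add] using h
  | cons r R ih =>
    simp only [Multiset.cons_add, sort_cons_eq_orderedInsert]
    exact orderedInsert_lt_orderedInsert r ih

theorem sort_lt_sort_of_forall_lt {A C : Multiset α} {c : α} (hc : c ∈ C)
    (h : ∀ a ∈ A, a < c) : A.sort (· ≥ ·) < C.sort (· ≥ ·) := by
  obtain ⟨C, rfl⟩ := Multiset.exists_cons_of_mem hc
  cases hM : (c ::ₘ C).sort (· ≥ ·) with
  | nil => simp [← List.length_eq_zero_iff] at hM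
  | cons d M =>
    have hcd : c ≤ d := by
      have hsorted := Multiset.pairwise_sort (c ::ₘ C) (· ≥ ·)
      have hmem : c ∈ (c ::ₘ C).sort (· ≥ ·) := by simp
      rw [hM] at hsorted hmem
      rcases List.mem_cons.1 hmem with rfl | hmem
      · exact le_rfl
      · exact List.rel_of_pairwise_cons hsorted hmem
    cases hL : A.sort (· ≥ ·) with
    | nil => exact .nil
    | cons a L =>
      have ha : a ∈ A := by simp [← Multiset.mem_sort (r := (· ≥ ·)), hL]
      exact .rel ((h a ha).trans_le hcd)

theorem DecLT.not_decLE {S : Type*} [Fintype S] {x y : S → α} (h : DecLT y x) : ¬ DecLE x y := by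
  have h : sortDown y < sortDown x := h
  rintro (hlt | heq)
  · exact lt_asymm h hlt
  · exact h.ne' heq

theorem decLT_of_forall_ne_lt {S : Type*} [Fintype S] {x y : S → α} {s : S} (hs : y s ≠ x s)
    (h : ∀ v, y v ≠ x v → y v < x s) : DecLT y x := by
  let U : Multiset S := Finset.univ.val
  have hsplit : ∀ z : S → α, U.map z =
      (U.filter fun v => y v = x v).map z + (U.filter fun v => y v ≠ x v).map z := fun z => by
    rw [← Multiset.map_add, Multiset.filter_add_not]
  have hcommon : (U.filter fun v => y v = x v).map y = (U.filter fun v => y v = x v).map x :=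
    Multiset.map_congr rfl fun v hv => (Multiset.mem_filter.1 hv).2
  change (U.map y).sort (· ≥ ·) < (U.map x).sort (· ≥ ·)
  rw [hsplit x, hsplit y, hcommon]
  refine sort_add_lt_sort_add _ (sort_lt_sort_of_forall_lt (c := x s) ?_ ?_)
  · exact Multiset.mem_map_of_mem x (Multiset.mem_filter.2 ⟨Finset.mem_univ s, hs⟩)
  · simpa [U] using h

end Lex

section Transfer

variable {S R : Type*} [DecidableEq S] [AddCommGroup R]

/-- The vector `x + a (χ_t - χ_s)`: an amount `a` is moved from component `s` of `x` to
component `t`. -/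
def transfer (x : S → R) (s t : S) (a : R) : S → R :=
  x + (Pi.single t a - Pi.single s a)

theorem sum_transfer (x : S → R) (s t : S) (a : R) (Z : Finset S) :
    ∑ v ∈ Z, transfer x s t a v =
      ∑ v ∈ Z, x v + ((if t ∈ Z then a else 0) - if s ∈ Z then a else 0) := by
  simp [transfer, Finset.sum_add_distrib, Finset.sum_sub_distrib]

theorem transfer_apply_source (x : S → R) {s t : S} (hst : s ≠ t) (a : R) :
    transfer x s t a s = x s - a := by
  simp [transfer, hst, sub_eq_add_neg]

theorem transfer_apply_target (x : S → R) {s t : S} (hst : s ≠ t) (a : R) :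
    transfer x s t a t = x t + a := by
  simp [transfer, hst.symm]

theorem transfer_apply_of_ne (x : S → R) {s t v : S} (hs : v ≠ s) (ht : v ≠ t) (a : R) :
    transfer x s t a v = x v := by
  simp [transfer, hs, ht]

theorem map_transfer {R' : Type*} [AddCommGroup R'] (f : R →+ R') (x : S → R) (s t : S) (a : R) :
    f ∘ transfer x s t a = transfer (f ∘ x) s t (f a) := by
  funext v
  simp [transfer, Pi.single_apply, apply_ite f]

/-- Some positive amount can be moved from component `s` of `x` to component `t` without
leaving `B`, i.e. `χ_t - χ_s` is a feasible direction at `x` when `B` is convex. -/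
def CanTransfer (B : Set (S → ℝ)) (x : S → ℝ) (s t : S) : Prop :=
  ∃ ε > 0, transfer x s t ε ∈ B

end Transfer

section Exchange

open scoped Topology

variable {S : Type*} {b : Finset S → WithTop ℝ} {x y : S → ℝ}

/-- The constraint `x(Z) ≤ b(Z)` holds with equality. -/
def IsTight (b : Finset S → WithTop ℝ) (x : S → ℝ) (Z : Finset S) : Prop :=
  ((∑ v ∈ Z, x v : ℝ) : WithTop ℝ) = b Z

variable [DecidableEq S]

theorem IsTight.add_le_sum_add_sum (hb : IsSubmodular b) {X Y : Finset S} (hX : IsTight b x X)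
    (hY : IsTight b y Y) :
    b (X ∩ Y) + b (X ∪ Y) ≤ ((∑ v ∈ X, x v + ∑ v ∈ Y, y v : ℝ) : WithTop ℝ) := by
  rw [WithTop.coe_add, hX, hY]
  exact hb X Y (hX ▸ WithTop.coe_ne_top) (hY ▸ WithTop.coe_ne_top)

variable [Fintype S]

theorem IsTight.inter_union (hb : IsSubmodular b) (hx : x ∈ basePolyhedron b) {X Y : Finset S}
    (hX : IsTight b x X) (hY : IsTight b x Y) : IsTight b x (X ∩ Y) ∧ IsTight b x (X ∪ Y) := by
  have hsub := hX.add_le_sum_add_sum hb hY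
  have hinter := hx.2 (X ∩ Y)
  have hunion := hx.2 (X ∪ Y)
  have hfinite := WithTop.add_ne_top.1 (ne_top_of_le_ne_top WithTop.coe_ne_top hsub)
  have hsum := Finset.sum_union_inter (s₁ := X) (s₂ := Y) (f := x)
  unfold IsTight
  lift b (X ∩ Y) to ℝ using hfinite.1 with p
  lift b (X ∪ Y) to ℝ using hfinite.2 with q
  norm_cast at *
  constructor <;> linarith

theorem IsTight.sum_sdiff_le_sum_sdiff (hb : IsSubmodular b) (hx : x ∈ basePolyhedron b)
    (hy : y ∈ basePolyhedron b) {X Y : Finset S} (hX : IsTight b x X) (hY : IsTight b y Y) :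
    ∑ v ∈ X \ Y, y v ≤ ∑ v ∈ X \ Y, x v := by
  have hsub : ∑ v ∈ X ∩ Y, x v + ∑ v ∈ X ∪ Y, y v ≤ ∑ v ∈ X, x v + ∑ v ∈ Y, y v := by
    exact_mod_cast (add_le_add (hx.2 _) (hy.2 _)).trans (hX.add_le_sum_add_sum hb hY)
  have hX_split := Finset.sum_inter_add_sum_sdiff X Y x
  have hunion_split := Finset.sum_sdiff (f := y) (Finset.subset_union_right (s₁ := X) (s₂ := Y))
  rw [Finset.union_sdiff_right] at hunion_split
  linarith

theorem exists_isLeast_isTight_mem (hb : IsSubmodular b) (hx : x ∈ basePolyhedron b) (s : S) :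
    ∃ D, IsLeast {Z | IsTight b x Z ∧ s ∈ Z} D := by
  have hclosed : InfClosed {Z | IsTight b x Z ∧ s ∈ Z} := fun X hX Y hY =>
    ⟨(hX.1.inter_union hb hx hY.1).1, Finset.mem_inter.2 ⟨hX.2, hY.2⟩⟩
  have hne : {Z | IsTight b x Z ∧ s ∈ Z}.Nonempty := ⟨Finset.univ, hx.1, Finset.mem_univ s⟩
  exact ((Set.toFinite _).exists_minimal hne).imp fun _ =>
    hclosed.codirectedOn.minimal_iff_isLeast.1

theorem exists_isGreatest_isTight_notMem (hb₀ : b ∅ = 0) (hb : IsSubmodular b)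
    (hx : x ∈ basePolyhedron b) (s : S) : ∃ E, IsGreatest {Z | IsTight b x Z ∧ s ∉ Z} E := by
  have hclosed : SupClosed {Z | IsTight b x Z ∧ s ∉ Z} := fun X hX Y hY =>
    ⟨(hX.1.inter_union hb hx hY.1).2, Finset.notMem_union.2 ⟨hX.2, hY.2⟩⟩
  have hne : {Z | IsTight b x Z ∧ s ∉ Z}.Nonempty :=
    ⟨∅, by simp [IsTight, hb₀], Finset.notMem_empty s⟩
  exact ((Set.toFinite _).exists_maximal hne).imp fun _ =>
    hclosed.directedOn.maximal_iff_isGreatest.1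

theorem transfer_mem_basePolyhedron_iff (hx : x ∈ basePolyhedron b) {s t : S} {a : ℝ}
    (ha : 0 ≤ a) : transfer x s t a ∈ basePolyhedron b ↔
      ∀ Z, t ∈ Z → s ∉ Z → ((∑ v ∈ Z, x v + a : ℝ) : WithTop ℝ) ≤ b Z := by
  constructor
  · intro h Z ht hs
    simpa [sum_transfer, ht, hs] using h.2 Z
  · refine fun h => ⟨by simpa [sum_transfer] using hx.1, fun Z => ?_⟩
    by_cases hZ : t ∈ Z ∧ s ∉ Z
    · simpa [sum_transfer, hZ.1, hZ.2] using h Z hZ.1 hZ.2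
    · refine (WithTop.coe_le_coe.2 ?_).trans (hx.2 Z)
      rw [sum_transfer]
      split_ifs <;> simp_all

theorem canTransfer_basePolyhedron (hx : x ∈ basePolyhedron b) {s t : S}
    (h : ∀ Z, IsTight b x Z → t ∈ Z → s ∈ Z) : CanTransfer (basePolyhedron b) x s t := by
  have hslack : ∀ Z, t ∈ Z → s ∉ Z →
      ∀ᶠ a in 𝓝[>] (0 : ℝ), ((∑ v ∈ Z, x v + a : ℝ) : WithTop ℝ) ≤ b Z := by
    intro Z ht hs
    have hlt := (hx.2 Z).lt_of_ne fun hZ => hs (h Z hZ ht)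
    cases hbZ : b Z with
    | top => simp
    | coe p =>
      have hpos : 0 < p - ∑ v ∈ Z, x v := sub_pos.2 (by rw [hbZ] at hlt; exact_mod_cast hlt)
      filter_upwards [Ioc_mem_nhdsGT hpos] with a ha
      exact_mod_cast add_le_of_le_sub_left ha.2
  have hall : ∀ᶠ a in 𝓝[>] (0 : ℝ), ∀ Z, t ∈ Z → s ∉ Z →
      ((∑ v ∈ Z, x v + a : ℝ) : WithTop ℝ) ≤ b Z := by
    simpa only [Filter.eventually_all] using hslack
  obtain ⟨ε, hε, hpos⟩ := (hall.and self_mem_nhdsWithin).exists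
  exact ⟨ε, hpos, (transfer_mem_basePolyhedron_iff hx hpos.le).2 hε⟩

theorem exists_simultaneous_exchange (hb₀ : b ∅ = 0) (hb : IsSubmodular b)
    (hx : x ∈ basePolyhedron b) (hy : y ∈ basePolyhedron b) {s : S} (hs : y s < x s) :
    ∃ t, x t < y t ∧ CanTransfer (basePolyhedron b) x s t ∧
      CanTransfer (basePolyhedron b) y t s := by
  obtain ⟨D, ⟨hD, hsD⟩, hD_le⟩ := exists_isLeast_isTight_mem hb hy s
  obtain ⟨E, ⟨hE, hsE⟩, hE_ge⟩ := exists_isGreatest_isTight_notMem hb₀ hb hx s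
  obtain ⟨t, ht, hlt⟩ : ∃ t ∈ D \ E, x t < y t := by
    by_contra! hle
    exact (hD.sum_sdiff_le_sum_sdiff hb hy hx hE).not_gt
      (Finset.sum_lt_sum hle ⟨s, Finset.mem_sdiff.2 ⟨hsD, hsE⟩, hs⟩)
  obtain ⟨htD, htE⟩ := Finset.mem_sdiff.1 ht
  refine ⟨t, hlt, canTransfer_basePolyhedron hx fun Z hZ htZ => ?_,
    canTransfer_basePolyhedron hy fun Z hZ hsZ => hD_le ⟨hZ, hsZ⟩ htD⟩
  by_contra hsZ
  exact htE (hE_ge ⟨hZ, hsZ⟩ htZ)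

end Exchange

section Integrality

variable {S : Type*} {B : Set (S → ℝ)}

theorem IsIntegralPolyhedron.convex (hB : IsIntegralPolyhedron B) : Convex ℝ B :=
  hB ▸ convex_convexHull ℝ _

theorem IsIntegralPolyhedron.exists_integralPoints_ge (hB : IsIntegralPolyhedron B)
    {f : (S → ℝ) → ℝ} (hf : ConvexOn ℝ Set.univ f) {x : S → ℝ} (hx : x ∈ B) :
    ∃ z ∈ integralPoints B, f x ≤ f fun s => (z s : ℝ) := by
  rw [← hB] at hx
  simpa only [Set.exists_mem_image] using hf.exists_ge_of_mem_convexHull (Set.subset_univ _) hx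

theorem convexOn_sum_apply (Z : Finset S) :
    ConvexOn ℝ Set.univ fun x : S → ℝ => ∑ v ∈ Z, x v := by
  have h := (∑ v ∈ Z, LinearMap.proj (R := ℝ) (φ := fun _ : S => ℝ) v).convexOn convex_univ
  simpa [Finset.sum_fn] using h

theorem CanTransfer.transfer_one_mem [Fintype S] [DecidableEq S] {b : Finset S → WithTop ℝ}
    (hB : IsIntegralPolyhedron (basePolyhedron b)) {m : S → ℤ}
    (hm : m ∈ integralPoints (basePolyhedron b)) {s t : S}
    (h : CanTransfer (basePolyhedron b) (fun v => (m v : ℝ)) s t) :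
    transfer m s t 1 ∈ integralPoints (basePolyhedron b) := by
  obtain ⟨ε, hε, hmem⟩ := h
  change Int.castAddHom ℝ ∘ transfer m s t 1 ∈ basePolyhedron b
  rw [map_transfer, show Int.castAddHom ℝ 1 = 1 from Int.cast_one]
  refine (transfer_mem_basePolyhedron_iff hm zero_le_one).2 ?_
  intro Z ht hs
  obtain ⟨z, hz, hle⟩ := hB.exists_integralPoints_ge (convexOn_sum_apply Z) hmem
  have hlt : (∑ v ∈ Z, (m v : ℝ)) < ∑ v ∈ Z, (z v : ℝ) :=
    (lt_add_of_pos_right _ hε).trans_le (by simpa [sum_transfer, ht, hs] using hle)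
  have hstep : (∑ v ∈ Z, (m v : ℝ)) + 1 ≤ ∑ v ∈ Z, (z v : ℝ) := by exact_mod_cast hlt
  exact (WithTop.coe_le_coe.2 hstep).trans (hz.2 Z)

end Integrality

section Optimality

theorem nonneg_of_forall_mul_add_sq_mul_nonneg {K : Type*} [Field K] [LinearOrder K]
    [IsStrictOrderedRing K] {p q : K} (h : ∀ a ∈ Set.Icc (0 : K) 1, 0 ≤ a * p + a ^ 2 * q) :
    0 ≤ p := by
  by_contra! hp
  have hpq : 0 ≤ p + q := by simpa using h 1 ⟨zero_le_one, le_rfl⟩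
  have hq : 0 < q := by linarith
  -- the vertex of the parabola
  set a := -p / (2 * q) with ha
  have ha_pos : 0 < a := div_pos (neg_pos.2 hp) (by positivity)
  have ha_le : a ≤ 1 := (div_le_one (by positivity)).2 (by linarith)
  have hvalue : a * p + a ^ 2 * q = a * (p / 2) := by
    rw [ha]
    field_simp
    ring
  have hneg : a * (p / 2) < 0 := mul_neg_of_pos_of_neg ha_pos (by linarith)
  exact hneg.not_ge (hvalue ▸ h a ⟨ha_pos.le, ha_le⟩)

variable {S : Type*} [Fintype S]

theorem IsMinNormPoint.dotProduct_sub_nonneg {B : Set (S → ℝ)} (hB : Convex ℝ B) {m x : S → ℝ}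
    (hm : IsMinNormPoint B m) (hx : x ∈ B) : 0 ≤ m ⬝ᵥ (x - m) := by
  suffices ∀ a ∈ Set.Icc (0 : ℝ) 1,
      0 ≤ a * (2 * m ⬝ᵥ (x - m)) + a ^ 2 * ((x - m) ⬝ᵥ (x - m)) from
    nonneg_of_mul_nonneg_right (nonneg_of_forall_mul_add_sq_mul_nonneg this) two_pos
  intro a ha
  have hle : m ⬝ᵥ m ≤ (m + a • (x - m)) ⬝ᵥ (m + a • (x - m)) := by
    simpa only [dotProduct, ← sq] using hm.2 _ (hB.add_smul_sub_mem hm.1 hx ha)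
  have hexpand : (m + a • (x - m)) ⬝ᵥ (m + a • (x - m)) =
      m ⬝ᵥ m + (a * (2 * m ⬝ᵥ (x - m)) + a ^ 2 * ((x - m) ⬝ᵥ (x - m))) := by
    simp only [add_dotProduct, dotProduct_add, smul_dotProduct, dotProduct_smul, smul_eq_mul,
      dotProduct_comm (x - m) m]
    ring
  rwa [hexpand, le_add_iff_nonneg_right] at hle

variable [DecidableEq S]

theorem IsMinNormPoint.le_of_canTransfer {B : Set (S → ℝ)} (hB : Convex ℝ B) {m : S → ℝ}
    (hm : IsMinNormPoint B m) {s t : S} (h : CanTransfer B m s t) : m s ≤ m t := by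
  obtain ⟨ε, hε, hmem⟩ := h
  have hnonneg := hm.dotProduct_sub_nonneg hB hmem
  rw [transfer, add_sub_cancel_left, dotProduct_sub, dotProduct_single, dotProduct_single,
    ← sub_mul] at hnonneg
  exact sub_nonneg.1 (nonneg_of_mul_nonneg_left hnonneg hε)

theorem IsDecMin.le_add_one_of_transfer_mem {Q : Set (S → ℤ)} {m : S → ℤ} (hm : IsDecMin Q m)
    {s t : S} (h : transfer m s t 1 ∈ Q) : m s ≤ m t + 1 := by
  by_contra! hlt
  have hst : s ≠ t := by
    rintro rfl
    omega
  have hs := transfer_apply_source m hst 1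
  have ht := transfer_apply_target m hst 1
  refine (decLT_of_forall_ne_lt (s := s) (by omega) fun v hv => ?_).not_decLE (hm.2 _ h)
  obtain rfl | rfl : v = s ∨ v = t := by
    by_contra! hne
    exact hv (transfer_apply_of_ne m hne.1 hne.2 1)
  all_goals omega

end Optimality

end DecMin

theorem mainTheorem1 {S : Type*} [Fintype S] [DecidableEq S] (B : Set (S → ℝ))
    (hB : DecMin.IsIntegralBasePolyhedron B)
    (mR : S → ℝ) (hmR : DecMin.IsMinNormPoint B mR)
    (mZ : S → ℤ) (hmZ : DecMin.IsDecMin (DecMin.integralPoints B) mZ) :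
    ∀ s : S, ⌊mR s⌋ ≤ mZ s ∧ mZ s ≤ ⌈mR s⌉ := by
  obtain ⟨⟨b, hb₀, hb, rfl⟩, hint⟩ := hB
  have hmR_le {s t} := hmR.le_of_canTransfer hint.convex (s := s) (t := t)
  have hmZ_le {s t} (h : DecMin.CanTransfer (DecMin.basePolyhedron b) (fun v => mZ v) s t) :
      (mZ s : ℝ) ≤ mZ t + 1 := by
    exact_mod_cast hmZ.le_add_one_of_transfer_mem (h.transfer_one_mem hint hmZ.1)
  intro s
  rw [Int.floor_le_iff, Int.le_ceil_iff]
  constructor <;> by_contra! hge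
  · obtain ⟨t, ht, hR, hZ⟩ :=
      DecMin.exists_simultaneous_exchange hb₀ hb hmR.1 hmZ.1 (s := s) (by linarith)
    linarith [hmR_le hR, hmZ_le hZ]
  · obtain ⟨t, ht, hZ, hR⟩ :=
      DecMin.exists_simultaneous_exchange hb₀ hb hmZ.1 hmR.1 (s := s) (by linarith)
    linarith [hmR_le hR, hmZ_le hZ]
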